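/- A (finite) hypergraph $H=(V,E)$ has a finite vertex set $V$ and a set $E$ of nonempty subsets of $V$, its hyperedges. A labeling $f$ of $V$ by positive integers is sum-distinguishing if $\sum_{v\in e}f(v)\neq\sum_{v\in e'}f(v)$ for any two distinct hyperedges $e,e'\in E$. Let $s(H)$ be the smallest integer $N$ such that $H$ has a sum-distinguishing labeling with each label at most $N$, and let $s(n,m)$ be the largest value of $s(H)$ over all hypergraphs $H$ with $n$ vertices and $m$ hyperedges. For every $C>0$ and $\varepsilon>0$ there is $n_0$ such that for all $n>n_0$ and all integers $m$ with $n\le m\le n^{1/\varepsilon}$, $$m^{2-\varepsilon}\le s(n,m)\le \frac{m^2}{C}.$$ Consequently, for $n\le m\le n^{O(1)}$, $s(n,m)=m^2/w$, where $w=w(n,m)$ goes to infinity and is smaller than any polynomial in $m$. That is, there is a function $w$ such that for all real $a$, $C$ and all $\delta>0$ there is $n_0$ such that for all $n>n_0$ and all integers $m$ with $n\le m\le n^{a}$ we have $s(n,m)=m^2/w(n,m)$ and $C\le w(n,m)\le m^{\delta}$. -/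

import Mathlib

namespace Hypergraph

/-- The sum of the labels of the vertices of the (finite) hyperedge `e`. -/
noncomputable def labelSum {α : Type*} (f : α → ℕ) (e : Set α) : ℕ :=
  ∑ᶠ v ∈ e, f v

/-- `f` labels the vertices of `H` by positive integers, and distinct hyperedges of `H` have
distinct label sums. -/
def IsSumDistinguishing {α : Type*} (H : Hypergraph α) (f : α → ℕ) : Prop :=
  (∀ v ∈ H.vertexSet, 1 ≤ f v) ∧
    ∀ e ∈ H.edgeSet, ∀ e' ∈ H.edgeSet, e ≠ e' → labelSum f e ≠ labelSum f e'

/-- The sum-distinguishing number `s(H)`: the smallest `N` such that `H` has a sum-distinguishing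
labeling with each label at most `N`. -/
noncomputable def sumDistNumber {α : Type*} (H : Hypergraph α) : ℕ :=
  sInf {N : ℕ | ∃ f : α → ℕ, H.IsSumDistinguishing f ∧ ∀ v ∈ H.vertexSet, f v ≤ N}

/-- The values `s(H)` over all hypergraphs `H` with `n` vertices (without loss of generality the
elements of `Fin n`) and `m` hyperedges; hyperedges are nonempty and not repeated. -/
def sumDistValues (n m : ℕ) : Set ℕ :=
  {k : ℕ | ∃ H : Hypergraph (Fin n), H.vertexSet = Set.univ ∧ ∅ ∉ H.edgeSet ∧
    H.edgeSet.ncard = m ∧ H.sumDistNumber = k}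

/-- `s(n, m)`: the largest value of `s(H)` over all hypergraphs with `n` vertices and `m`
hyperedges. -/
noncomputable def maxSumDistNumber (n m : ℕ) : ℕ :=
  sSup (sumDistValues n m)

/-- `s(H)` is well defined (as a minimum): labeling by distinct powers of two works. -/
theorem isLeast_sumDistNumber {n : ℕ} (H : Hypergraph (Fin n)) :
    IsLeast {N : ℕ | ∃ f : Fin n → ℕ, H.IsSumDistinguishing f ∧ ∀ v ∈ H.vertexSet, f v ≤ N}
      H.sumDistNumber := by
  classical
  have hne : {N : ℕ | ∃ f : Fin n → ℕ, H.IsSumDistinguishing f ∧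
      ∀ v ∈ H.vertexSet, f v ≤ N}.Nonempty := by
    refine ⟨2 ^ n, fun v => 2 ^ (v : ℕ), ⟨fun v _ => Nat.one_le_two_pow, ?_⟩,
      fun v _ => Nat.pow_le_pow_right (by norm_num) v.isLt.le⟩
    intro e _ e' _ hee h
    apply hee
    have key : ∀ s : Set (Fin n), labelSum (fun v : Fin n => 2 ^ (v : ℕ)) s
        = ∑ i ∈ s.toFinset.map Fin.valEmbedding, 2 ^ i := by
      intro s
      rw [labelSum, finsum_mem_eq_toFinset_sum, Finset.sum_map]
      rfl
    rw [key, key] at h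
    have h2 := congrArg (fun k : ℕ => k.bitIndices.toFinset) h
    simp only [Finset.toFinset_bitIndices_sum_two_pow] at h2
    simpa using Finset.map_injective _ h2
  exact ⟨Nat.sInf_mem hne, fun N hN => Nat.sInf_le hN⟩

/-- `s(n, m)` is well defined (as a maximum) as soon as `m ≤ 2 ^ n - 1`. -/
theorem isGreatest_maxSumDistNumber {n m : ℕ} (hm : m ≤ 2 ^ n - 1) :
    IsGreatest (sumDistValues n m) (maxSumDistNumber n m) := by
  classical
  have hfin : (sumDistValues n m).Finite := by
    have : Finite (Hypergraph (Fin n)) :=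
      Finite.of_injective (fun H : Hypergraph (Fin n) => (H.vertexSet, H.edgeSet))
        (fun H H' h => Hypergraph.ext (Prod.ext_iff.1 h).1 (Prod.ext_iff.1 h).2)
    refine (Set.finite_range (fun H : Hypergraph (Fin n) => H.sumDistNumber)).subset ?_
    rintro k ⟨H, -, -, -, rfl⟩
    exact ⟨H, rfl⟩
  have hne : (sumDistValues n m).Nonempty := by
    have hc : m ≤ ((Finset.univ : Finset (Set (Fin n))).erase ∅).card := by
      rw [Finset.card_erase_of_mem (Finset.mem_univ _), Finset.card_univ, Fintype.card_set,
        Fintype.card_fin]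
      exact hm
    obtain ⟨T, hT, hTm⟩ := Finset.exists_subset_card_eq hc
    refine ⟨_, ⟨Set.univ, (T : Set (Set (Fin n))), fun _ _ => Set.subset_univ _⟩, rfl, ?_, ?_, rfl⟩
    · intro h
      exact (Finset.mem_erase.1 (hT (Finset.mem_coe.1 h))).1 rfl
    · simpa using hTm
  exact ⟨Nat.sSup_mem hne hfin.bddAbove, fun k hk => le_csSup hfin.bddAbove hk⟩

end Hypergraph

open Finset

/-! Upper bound. Take uniformly random labels in `[1, 2M]` with `2M` about `m ^ 2 / C`. Two distinct
edges collide with probability at most `1 / (2M)`, so the expected number of ordered collisions is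
at most `2C`, a constant rather than zero. The survivors are repaired one at a time: pick `v` in the
symmetric difference of a colliding pair and give it a new label. Each pair separated by `v` forbids
at most one label, so the repair works once fewer than `2M` such pairs matter.

Pairs with symmetric difference at least `2q` rarely matter: by Littlewood–Offord
anti-concentration, only a small fraction of them have sums within a constant multiple of `M`, and a
bounded number of relabelings cannot bring the others together. Pairs with symmetric difference
below `2q` have bounded total degree, so only a bounded set `W` of vertices separates too many of
them. At most `m * 2 ^ #W` pairs differ only inside `W`; this is linear in `m`, so with good
probability none of them collides, and every collision can be repaired at a vertex outside `W`. The
two halves are `exists_labeling_card_collisions_le` (random labeling) and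
`exists_labeling_of_card_collisions_le` (repair).

Lower bound. Count families of `m` sets of constant size `k` inside a set `U` of about `m ^ (ε / 2)`
vertices. With labels at most `N = m ^ (2 - ε)`, all sums lie among `k * N` values, so, as in the
birthday problem, a fixed labeling separates only about an `exp (-m ^ 2 / (4 * k * N))` fraction of
the families. There are only `N ^ #U` labelings of `U`, and `#U * log N` is much smaller than `m ^ 2
/ N = m ^ ε`, so a union bound leaves a family that no labeling separates
(`exists_family_not_injOn`). -/

/-! ### Collision probability and anti-concentration -/

lemma card_collision_mul_le {V A : Type*} [Fintype V] [DecidableEq V] [Fintype A] [DecidableEq A]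
    {l : A → ℕ} (hl : Function.Injective l) {e e' : Finset V} (h : e ≠ e') :
    #{f : V → A | ∑ v ∈ e, l (f v) = ∑ v ∈ e', l (f v)} * Fintype.card A ≤
      Fintype.card (V → A) := by
  classical
  obtain ⟨v, hv⟩ : ∃ v, ¬ (v ∈ e ↔ v ∈ e') := by
    by_contra! hc
    exact h (Finset.ext hc)
  wlog hve : v ∈ e generalizing e e'
  · have := this h.symm (by tauto) (by tauto)
    simpa [eq_comm] using this
  have hve' : v ∉ e' := by tauto
  rw [← Finset.card_univ (α := A), ← Finset.card_product, ← Finset.card_univ]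
  -- Overwriting the label at `v` loses nothing: the collision equation determines it from the other
  -- labels.
  refine Finset.card_le_card_of_injOn (fun p => Function.update p.1 v p.2) (by simp) ?_
  rintro ⟨f, a⟩ hf ⟨g, b⟩ hg hfg
  simp only [coe_product, Set.mem_prod, mem_coe, mem_filter, mem_univ, true_and, coe_univ,
    Set.mem_univ, and_true] at hf hg hfg
  have hne : ∀ u, u ≠ v → f u = g u := fun u hu => by
    have := congrFun hfg u
    simpa [Function.update_of_ne hu] using this
  have hab : a = b := by simpa using congrFun hfg v
  have h' : ∑ u ∈ e', l (f u) = ∑ u ∈ e', l (g u) :=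
    Finset.sum_congr rfl fun u hu => by rw [hne u (fun h => hve' (h ▸ hu))]
  have h'' : ∑ u ∈ e.erase v, l (f u) = ∑ u ∈ e.erase v, l (g u) :=
    Finset.sum_congr rfl fun u hu => by rw [hne u (Finset.ne_of_mem_erase hu)]
  rw [← Finset.add_sum_erase _ _ hve] at hf hg
  have hv' : f v = g v := hl (by omega)
  have : f = g := funext fun u => by
    by_cases hu : u = v
    · rw [hu, hv']
    · exact hne u hu
  rw [this, hab]

/-- Littlewood–Offord for signs: fix `B` outside a `2q`-subset `S` of the symmetric difference.
Complementing `B` on `e' \ e` turns the signed count on `S` into a cardinality up to a constant, so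
the admissible `B` form a single layer of the cube on `S`, of size at most the central binomial
coefficient. -/
lemma card_inter_sub_card_inter_eq_mul_le {V : Type*} [Fintype V] [DecidableEq V]
    (e e' : Finset V) {q : ℕ} (hq : 2 * q ≤ #(symmDiff e e')) (t : ℤ) :
    #{B : Finset V | (#(B ∩ e) : ℤ) - #(B ∩ e') = t} * 4 ^ q ≤
      Nat.centralBinom q * 2 ^ Fintype.card V := by
  obtain ⟨S, hS, hScard⟩ := Finset.exists_subset_card_eq hq
  have hSV : 2 * q ≤ Fintype.card V := hScard ▸ Finset.card_le_univ S
  have key : #{B : Finset V | (#(B ∩ e) : ℤ) - #(B ∩ e') = t} ≤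
      Nat.centralBinom q * #(Sᶜ.powerset) := by
    refine Finset.card_le_mul_card_image_of_maps_to (f := fun B => B \ S) ?_ _ ?_
    · intro B _
      simp only [mem_powerset]
      intro x hx
      simp at hx ⊢
      exact hx.2
    · intro R _
      set F := {B ∈ ({B : Finset V | (#(B ∩ e) : ℤ) - #(B ∩ e') = t} : Finset (Finset V)) |
        B \ S = R} with hF
      have hval : ∀ B ∈ F, (#(symmDiff B (e' \ e) ∩ S) : ℤ) =
          t - #(R ∩ e) + #(R ∩ e') + #(S ∩ e') := by
        intro B hB
        simp only [hF, mem_filter, mem_univ, true_and] at hB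
        obtain ⟨hB, rfl⟩ := hB
        have h1 : #(B ∩ e) = #((B \ S) ∩ e) + #(B ∩ S ∩ e) := by
          rw [← Finset.card_union_of_disjoint]
          · congr 1; ext x; simp; tauto
          · rw [Finset.disjoint_left]; intro x; simp; tauto
        have h2 : #(B ∩ e') = #((B \ S) ∩ e') + #(B ∩ S ∩ e') := by
          rw [← Finset.card_union_of_disjoint]
          · congr 1; ext x; simp; tauto
          · rw [Finset.disjoint_left]; intro x; simp; tauto
        have hS' : ∀ x ∈ S, ((x ∈ e ∧ x ∉ e') ∨ (x ∈ e' ∧ x ∉ e)) := fun x hx => by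
          simpa [Finset.mem_symmDiff] using hS hx
        have h3 : #(S ∩ e') = #(B ∩ S ∩ e') + #((S ∩ e') \ B) := by
          rw [← Finset.card_union_of_disjoint]
          · congr 1; ext x; simp; tauto
          · rw [Finset.disjoint_left]; intro x; simp; tauto
        have h4 : #(symmDiff B (e' \ e) ∩ S) = #(B ∩ S ∩ e) + #((S ∩ e') \ B) := by
          rw [← Finset.card_union_of_disjoint]
          · congr 1; ext x
            have := hS' x
            simp [Finset.mem_symmDiff]; tauto
          · rw [Finset.disjoint_left]; intro x; simp; tauto
        push_cast [h1, h2, h3, h4] at hB ⊢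
        linarith
      rcases F.eq_empty_or_nonempty with h0 | ⟨B₀, hB₀⟩
      · simp [h0]
      · calc #F ≤ #(S.powersetCard #(symmDiff B₀ (e' \ e) ∩ S)) := by
              refine Finset.card_le_card_of_injOn (fun B => symmDiff B (e' \ e) ∩ S) ?_ ?_
              · intro B hB
                simp only [mem_coe, mem_powersetCard]
                refine ⟨Finset.inter_subset_right, ?_⟩
                have := (hval B hB).trans (hval B₀ hB₀).symm
                exact_mod_cast this
              · intro B hB B' hB' hBB
                simp only [hF, coe_filter, mem_filter, mem_univ, true_and, Set.mem_ofPred_eq]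
                  at hB hB'
                have h1 := hB.2.trans hB'.2.symm
                ext x
                have h2 := Finset.ext_iff.1 h1 x
                have h3 := Finset.ext_iff.1 hBB x
                simp [Finset.mem_symmDiff] at h2 h3
                tauto
          _ ≤ _ := by
              rw [Finset.card_powersetCard, hScard]
              exact Nat.choose_le_centralBinom _ _
  rw [Finset.card_powerset, Finset.card_compl, hScard] at key
  calc _ ≤ _ := Nat.mul_le_mul_right _ key
    _ = _ := by
      rw [mul_assoc, show 4 = 2 ^ 2 by norm_num, ← pow_mul, ← pow_add, Nat.sub_add_cancel hSV]

/-- Labels in `[1, 2M]`, split into a leading bit and a remainder. -/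
def bitLabel (M : ℕ) (a : Bool × Fin M) : ℕ := 1 + a.2 + if a.1 then M else 0

lemma bitLabel_injective (M : ℕ) : Function.Injective (bitLabel M) := by
  rintro ⟨a, i⟩ ⟨b, j⟩ h
  have := i.2
  have := j.2
  simp only [bitLabel] at h
  cases a <;> cases b <;> simp at h ⊢ <;> omega

lemma one_le_bitLabel {M : ℕ} (a : Bool × Fin M) : 1 ≤ bitLabel M a := by
  simp only [bitLabel]; omega

lemma bitLabel_le {M : ℕ} (a : Bool × Fin M) : bitLabel M a ≤ 2 * M := by
  have := a.2.2
  simp only [bitLabel]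
  split_ifs <;> omega

/-- Conditioned on the remainders, the difference of sums is a constant plus `M` times the signed
count of the leading bits. A window of half-width `2 * K * M` thus admits at most `8 * K + 1` values
of that count. -/
lemma card_close_mul_le {V : Type*} [Fintype V] [DecidableEq V] {M : ℕ} (K : ℕ)
    (e e' : Finset V) {q : ℕ} (hq : 2 * q ≤ #(symmDiff e e')) :
    #{f : V → Bool × Fin M | |(∑ v ∈ e, (bitLabel M (f v) : ℤ)) - ∑ v ∈ e', (bitLabel M (f v) : ℤ)|
        ≤ K * (2 * M)} * 4 ^ q ≤
      (8 * K + 1) * Nat.centralBinom q * Fintype.card (V → Bool × Fin M) := by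
  classical
  rcases Nat.eq_zero_or_pos M with rfl | hM
  · rcases isEmpty_or_nonempty V with hV | ⟨⟨v⟩⟩
    · have : q = 0 := by
        have : #(symmDiff e e') = 0 := by
          rw [Finset.card_eq_zero]; ext v; exact hV.elim v
        omega
      subst this
      simp only [pow_zero, mul_one, Nat.centralBinom_zero]
      calc _ ≤ Fintype.card (V → Bool × Fin 0) := Finset.card_le_univ _
        _ ≤ _ := Nat.le_mul_of_pos_left _ (by omega)
    · have : IsEmpty (V → Bool × Fin 0) := ⟨fun f => (f v).2.elim0⟩
      simp
  have hsum : ∀ (B : Finset V) (g : V → Fin M) (s : Finset V),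
      ∑ v ∈ s, (bitLabel M (decide (v ∈ B), g v) : ℤ) =
        (∑ v ∈ s, (1 + (g v : ℤ))) + M * #(B ∩ s) := by
    intro B g s
    simp only [bitLabel, decide_eq_true_eq]
    push_cast
    rw [Finset.sum_add_distrib]
    congr 1
    rw [← Finset.sum_filter, Finset.sum_const, Finset.filter_mem_eq_inter, Finset.inter_comm]
    simp [mul_comm]
  have key : ∀ g : V → Fin M, #{B : Finset V |
      |(∑ v ∈ e, (bitLabel M (decide (v ∈ B), g v) : ℤ)) -
        ∑ v ∈ e', (bitLabel M (decide (v ∈ B), g v) : ℤ)| ≤ K * (2 * M)} * 4 ^ q ≤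
      (8 * K + 1) * (Nat.centralBinom q * 2 ^ Fintype.card V) := by
    intro g
    set F := ({B : Finset V |
      |(∑ v ∈ e, (bitLabel M (decide (v ∈ B), g v) : ℤ)) -
        ∑ v ∈ e', (bitLabel M (decide (v ∈ B), g v) : ℤ)| ≤ K * (2 * M)} : Finset (Finset V))
      with hF
    rcases F.eq_empty_or_nonempty with h0 | ⟨B₀, hB₀⟩
    · simp [h0]
    set t₀ : ℤ := (#(B₀ ∩ e) : ℤ) - #(B₀ ∩ e') with ht₀
    have hsub : F ⊆ (Finset.Icc (t₀ - 4 * K) (t₀ + 4 * K)).biUnion fun t =>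
        {B : Finset V | (#(B ∩ e) : ℤ) - #(B ∩ e') = t} := by
      intro B hB
      simp only [hF, mem_filter, mem_univ, true_and, hsum, abs_le] at hB hB₀
      simp only [mem_biUnion, mem_filter, mem_univ, true_and, exists_eq_right', mem_Icc]
      have hM' : (0 : ℤ) < M := by exact_mod_cast hM
      constructor
      · refine le_of_mul_le_mul_left ?_ hM'
        rw [ht₀]; linarith [hB.1, hB₀.2]
      · refine le_of_mul_le_mul_left ?_ hM'
        rw [ht₀]; linarith [hB.2, hB₀.1]
    calc #F * 4 ^ q ≤ (∑ t ∈ Finset.Icc (t₀ - 4 * K) (t₀ + 4 * K),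
          #{B : Finset V | (#(B ∩ e) : ℤ) - #(B ∩ e') = t}) * 4 ^ q :=
          Nat.mul_le_mul_right _ ((Finset.card_le_card hsub).trans Finset.card_biUnion_le)
      _ ≤ ∑ t ∈ Finset.Icc (t₀ - 4 * K) (t₀ + 4 * K),
          Nat.centralBinom q * 2 ^ Fintype.card V := by
          rw [Finset.sum_mul]
          exact Finset.sum_le_sum fun t _ => card_inter_sub_card_inter_eq_mul_le e e' hq t
      _ = _ := by
          rw [Finset.sum_const, Int.card_Icc, smul_eq_mul]
          congr 1
          omega
  set P := ({f : V → Bool × Fin M | |(∑ v ∈ e, (bitLabel M (f v) : ℤ)) -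
    ∑ v ∈ e', (bitLabel M (f v) : ℤ)| ≤ K * (2 * M)} : Finset _) with hP
  have hcard : #P ≤ ∑ g : V → Fin M, #{B : Finset V |
      |(∑ v ∈ e, (bitLabel M (decide (v ∈ B), g v) : ℤ)) -
        ∑ v ∈ e', (bitLabel M (decide (v ∈ B), g v) : ℤ)| ≤ K * (2 * M)} := by
    rw [← Finset.card_sigma]
    refine Finset.card_le_card_of_injOn
      (fun f => ⟨fun v => (f v).2, Finset.univ.filter fun v => (f v).1 = true⟩) ?_ ?_
    · intro f hf
      simpa [hP] using hf
    · intro f _ f' _ hff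
      simp only [Sigma.mk.injEq, heq_eq_eq] at hff
      funext v
      have h1 := congrFun hff.1 v
      have h2 := Finset.ext_iff.1 hff.2 v
      simp only [mem_filter, mem_univ, true_and] at h2
      exact Prod.ext (Bool.eq_iff_iff.2 h2) h1
  calc #P * 4 ^ q ≤ _ := Nat.mul_le_mul_right _ hcard
    _ ≤ ∑ g : V → Fin M, (8 * K + 1) * (Nat.centralBinom q * 2 ^ Fintype.card V) := by
        rw [Finset.sum_mul]
        exact Finset.sum_le_sum fun g _ => key g
    _ = _ := by
        simp [mul_pow]
        ring

/-- A Wallis-type bound: the central binomial coefficient is at most `4 ^ q / √(2q + 1)`, so its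
share of the cube tends to zero. -/
lemma centralBinom_sq_mul_le (q : ℕ) : Nat.centralBinom q ^ 2 * (2 * q + 1) ≤ 16 ^ q := by
  induction q with
  | zero => simp
  | succ q ih =>
    have h := Nat.succ_mul_centralBinom_succ q
    have hpos : 0 < (q + 1) ^ 2 := by positivity
    refine Nat.le_of_mul_le_mul_left ?_ hpos
    calc (q + 1) ^ 2 * (Nat.centralBinom (q + 1) ^ 2 * (2 * (q + 1) + 1))
        = ((q + 1) * Nat.centralBinom (q + 1)) ^ 2 * (2 * q + 3) := by ring
      _ = (Nat.centralBinom q ^ 2 * (2 * q + 1)) * (4 * ((2 * q + 1) * (2 * q + 3))) := by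
          rw [h]; ring
      _ ≤ 16 ^ q * (4 * (4 * (q + 1) ^ 2)) := by
          have : (2 * q + 1) * (2 * q + 3) ≤ 4 * (q + 1) ^ 2 := by nlinarith
          exact Nat.mul_le_mul ih (Nat.mul_le_mul_left 4 this)
      _ = _ := by ring

lemma exists_mul_centralBinom_le (a : ℕ) : ∃ q : ℕ, a * Nat.centralBinom q ≤ 4 ^ q := by
  refine ⟨a ^ 2, ?_⟩
  refine (Nat.pow_le_pow_iff_left (n := 2) (by norm_num)).1 ?_
  calc (a * Nat.centralBinom (a ^ 2)) ^ 2 = Nat.centralBinom (a ^ 2) ^ 2 * a ^ 2 := by ring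
    _ ≤ Nat.centralBinom (a ^ 2) ^ 2 * (2 * a ^ 2 + 1) := by gcongr; omega
    _ ≤ _ := centralBinom_sq_mul_le _
    _ = _ := by rw [← pow_mul, mul_comm, pow_mul]; norm_num

/-! ### Repairing collisions by relabeling single vertices -/

lemma sum_update_eq_add_ite {V : Type*} [DecidableEq V] (f : V → ℕ) (v : V) (a : ℕ)
    (s : Finset V) :
    ∑ u ∈ s, (Function.update f v a u : ℤ) =
      (∑ u ∈ s, (f u : ℤ)) + if v ∈ s then (a : ℤ) - f v else 0 := by
  split_ifs with hs
  · rw [← Finset.add_sum_erase _ _ hs, ← Finset.add_sum_erase _ (fun u => (f u : ℤ)) hs,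
      Finset.sum_congr rfl (g := fun u => (f u : ℤ)) fun u hu => by
        rw [Function.update_of_ne (Finset.ne_of_mem_erase hu)]]
    simp only [Function.update_self]
    ring
  · rw [add_zero]
    refine Finset.sum_congr rfl fun u hu => ?_
    rw [Function.update_of_ne]
    rintro rfl
    exact hs hu

lemma sum_update_sub_sum_update_of_iff {V : Type*} [DecidableEq V] (f : V → ℕ) {v : V} (a : ℕ)
    {e e' : Finset V} (h : v ∈ e ↔ v ∈ e') :
    (∑ u ∈ e, (Function.update f v a u : ℤ)) - ∑ u ∈ e', (Function.update f v a u : ℤ) =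
      (∑ u ∈ e, (f u : ℤ)) - ∑ u ∈ e', (f u : ℤ) := by
  simp only [sum_update_eq_add_ite, h]
  ring

lemma sum_update_sub_sum_update_of_mem {V : Type*} [DecidableEq V] (f : V → ℕ) {v : V} (a : ℕ)
    {e e' : Finset V} (h : v ∈ e) (h' : v ∉ e') :
    (∑ u ∈ e, (Function.update f v a u : ℤ)) - ∑ u ∈ e', (Function.update f v a u : ℤ) =
      (∑ u ∈ e, (f u : ℤ)) - ∑ u ∈ e', (f u : ℤ) + (a - f v) := by
  simp only [sum_update_eq_add_ite, h, h', if_true, if_false]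
  ring

lemma sum_update_sub_sum_update_of_notMem {V : Type*} [DecidableEq V] (f : V → ℕ) {v : V} (a : ℕ)
    {e e' : Finset V} (h : v ∉ e) (h' : v ∈ e') :
    (∑ u ∈ e, (Function.update f v a u : ℤ)) - ∑ u ∈ e', (Function.update f v a u : ℤ) =
      (∑ u ∈ e, (f u : ℤ)) - ∑ u ∈ e', (f u : ℤ) - (a - f v) := by
  simp only [sum_update_eq_add_ite, h, h', if_true, if_false]
  ring

/-- The ordered pairs of distinct members of `E` with equal label sums. -/
def collisions {V : Type*} [DecidableEq V] (E : Finset (Finset V)) (f : V → ℕ) :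
    Finset (Finset V × Finset V) :=
  {p ∈ E ×ˢ E | p.1 ≠ p.2 ∧ ∑ v ∈ p.1, f v = ∑ v ∈ p.2, f v}

/-- The pairs of members of `E` outside `A` whose label sums differ by at most `r`. -/
def closePairs {V : Type*} [DecidableEq V] (E : Finset (Finset V))
    (A : Finset (Finset V × Finset V)) (f : V → ℕ) (r : ℤ) : Finset (Finset V × Finset V) :=
  {p ∈ E ×ˢ E | p ∉ A ∧ |(∑ v ∈ p.1, (f v : ℤ)) - ∑ v ∈ p.2, (f v : ℤ)| ≤ r}

/-- Collisions can be repaired one at a time by relabeling a single vertex outside `W`. -/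
lemma exists_labeling_of_card_collisions_le {V : Type*} [DecidableEq V]
    (E : Finset (Finset V)) (A : Finset (Finset V × Finset V)) (W : Finset V) {N a b : ℕ}
    (hab : a + b < N) (hA : ∀ v, v ∉ W → #{p ∈ A | v ∈ symmDiff p.1 p.2} ≤ a)
    (c : ℕ) (f : V → ℕ) (hf : ∀ v, f v ∈ Finset.Icc 1 N)
    (hW : ∀ p ∈ collisions E f, ¬ symmDiff p.1 p.2 ⊆ W)
    (hc : #(collisions E f) ≤ c) (hb : #(closePairs E A f ((c + 1) * N)) ≤ b) :
    ∃ g : V → ℕ, (∀ v, g v ∈ Finset.Icc 1 N) ∧ collisions E g = ∅ := by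
  -- `c` bounds both the collisions left and the repairs still needed. Each repair costs one `N` of
  -- the closeness radius, so the close-pair bound `b` survives to the end.
  induction c generalizing f with
  | zero => exact ⟨f, hf, Finset.card_eq_zero.1 (by omega)⟩
  | succ c ih =>
    rcases (collisions E f).eq_empty_or_nonempty with h0 | ⟨p₀, hp₀⟩
    · exact ⟨f, hf, h0⟩
    obtain ⟨v, hv, hvW⟩ := Finset.not_subset.1 (hW p₀ hp₀)
    have hfv := Finset.mem_Icc.1 (hf v)
    -- the pairs which some relabeling of `v` could turn into collisions
    set T := {p ∈ A | v ∈ symmDiff p.1 p.2} ∪ closePairs E A f (((c + 1 : ℕ) + 1) * N) with hT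
    have hTcard : #T < #(Finset.Icc 1 N) := by
      rw [Nat.card_Icc]
      have : #T ≤ _ := Finset.card_union_le _ _
      have := hA v hvW
      omega
    -- The only label at `v` that could make `p` collide when `v` separates `p`. Truncation by
    -- `toNat` at worst forbids a superfluous label.
    let val : Finset V × Finset V → ℕ := fun p =>
      if v ∈ p.1 then (f v - ((∑ u ∈ p.1, (f u : ℤ)) - ∑ u ∈ p.2, (f u : ℤ))).toNat
      else (f v + ((∑ u ∈ p.1, (f u : ℤ)) - ∑ u ∈ p.2, (f u : ℤ))).toNat
    obtain ⟨x, hx, hxT⟩ : ∃ x ∈ Finset.Icc 1 N, x ∉ T.image val := by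
      by_contra! hcon
      exact absurd ((Finset.card_le_card hcon).trans Finset.card_image_le) (by omega)
    have hx' := Finset.mem_Icc.1 hx
    have hmove : ∀ p : Finset V × Finset V,
        |(∑ u ∈ p.1, (f u : ℤ)) - ∑ u ∈ p.2, (f u : ℤ)| ≤
        |(∑ u ∈ p.1, (Function.update f v x u : ℤ)) - ∑ u ∈ p.2, (Function.update f v x u : ℤ)|
          + N := by
      intro p
      have hxf : |(x : ℤ) - f v| ≤ N := by rw [abs_le]; constructor <;> omega
      by_cases h1 : v ∈ p.1 <;> by_cases h2 : v ∈ p.2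
      · rw [sum_update_sub_sum_update_of_iff f x (by tauto)]; linarith
      · rw [sum_update_sub_sum_update_of_mem f x h1 h2]
        rw [abs_le] at hxf
        grind
      · rw [sum_update_sub_sum_update_of_notMem f x h1 h2]
        rw [abs_le] at hxf
        grind
      · rw [sum_update_sub_sum_update_of_iff f x (by tauto)]; linarith
    have hsep : ∀ p ∈ collisions E (Function.update f v x), v ∉ symmDiff p.1 p.2 := by
      intro p hp hvp
      simp only [collisions, mem_filter, mem_product] at hp
      obtain ⟨hpE, -, hpsum⟩ := hp
      have hpz : (∑ u ∈ p.1, (Function.update f v x u : ℤ)) -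
          ∑ u ∈ p.2, (Function.update f v x u : ℤ) = 0 := by
        rw [sub_eq_zero]; exact_mod_cast hpsum
      have hpT : p ∈ T := by
        rw [hT, mem_union]
        by_cases hpA : p ∈ A
        · left; simp [hpA, hvp]
        · right
          simp only [closePairs, mem_filter, mem_product]
          refine ⟨hpE, hpA, ?_⟩
          have := hmove p
          rw [hpz, abs_zero, zero_add] at this
          push_cast
          nlinarith
      refine hxT (Finset.mem_image.2 ⟨p, hpT, ?_⟩)
      rw [Finset.mem_symmDiff] at hvp
      rcases hvp with ⟨h1, h2⟩ | ⟨h2, h1⟩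
      · rw [sum_update_sub_sum_update_of_mem f x h1 h2] at hpz
        simp only [val, h1, if_true]
        omega
      · rw [sum_update_sub_sum_update_of_notMem f x h1 h2] at hpz
        simp only [val, h1, if_false]
        omega
    -- Pairs not separated by `v` keep their difference, so no new collision appears and `p₀`
    -- disappears.
    have hsub : collisions E (Function.update f v x) ⊆ (collisions E f).erase p₀ := by
      intro p hp
      have hvp := hsep p hp
      rw [Finset.mem_erase]
      refine ⟨fun h => hvp (h ▸ hv), ?_⟩
      simp only [collisions, mem_filter] at hp ⊢
      refine ⟨hp.1, hp.2.1, ?_⟩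
      have h1 := sum_update_sub_sum_update_of_iff f (v := v) x (e := p.1) (e' := p.2) (by
        rw [Finset.mem_symmDiff] at hvp; tauto)
      have h2 : (∑ u ∈ p.1, (Function.update f v x u : ℤ)) =
          ∑ u ∈ p.2, (Function.update f v x u : ℤ) := by exact_mod_cast hp.2.2
      rw [h2, sub_self] at h1
      have h3 := (sub_eq_zero.1 h1.symm)
      exact_mod_cast h3
    refine ih (Function.update f v x) ?_ ?_ ?_ ?_
    · intro u
      by_cases hu : u = v
      · subst hu; simpa using hx
      · rw [Function.update_of_ne hu]; exact hf u
    · exact fun p hp => hW p (Finset.mem_of_mem_erase (hsub hp))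
    · have := Finset.card_le_card hsub
      rw [Finset.card_erase_of_mem hp₀] at this
      omega
    · refine (Finset.card_le_card ?_).trans hb
      intro p hp
      simp only [closePairs, mem_filter] at hp ⊢
      refine ⟨hp.1, hp.2.1, (hmove p).trans ?_⟩
      push_cast
      linarith [hp.2.2]

/-! ### First-moment estimates for the random labeling -/

lemma card_filter_symmDiff_subset_le {V : Type*} [DecidableEq V] (E : Finset (Finset V))
    (W : Finset V) : #{p ∈ E ×ˢ E | symmDiff p.1 p.2 ⊆ W} ≤ #E * 2 ^ #W := by
  rw [← Finset.card_powerset, ← Finset.card_product]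
  refine Finset.card_le_card_of_injOn (fun p => (p.1, symmDiff p.1 p.2)) ?_ ?_
  · intro p hp
    simp only [coe_filter, mem_product, Set.mem_ofPred_eq] at hp
    simp only [coe_product, Set.mem_prod, mem_coe, mem_powerset]
    exact ⟨hp.1.1, hp.2⟩
  · rintro ⟨a, b⟩ _ ⟨c, d⟩ _ h
    simp only [Prod.mk.injEq] at h ⊢
    obtain ⟨rfl, h⟩ := h
    exact ⟨rfl, symmDiff_right_injective a h⟩

/-- Double counting of incidences between vertices and symmetric differences, followed by Markov; it
bounds the size of the exceptional set `W`. -/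
lemma card_heavy_mul_le {V : Type*} [Fintype V] [DecidableEq V]
    (A : Finset (Finset V × Finset V)) {d : ℕ} (hd : ∀ p ∈ A, #(symmDiff p.1 p.2) ≤ d) (a : ℕ) :
    #{v : V | a < #{p ∈ A | v ∈ symmDiff p.1 p.2}} * (a + 1) ≤ d * #A := by
  calc _ ≤ ∑ v ∈ ({v : V | a < #{p ∈ A | v ∈ symmDiff p.1 p.2}} : Finset V),
        #{p ∈ A | v ∈ symmDiff p.1 p.2} := by
        rw [← smul_eq_mul]
        refine Finset.card_nsmul_le_sum _ _ _ fun v hv => ?_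
        simp only [mem_filter, mem_univ, true_and] at hv
        omega
    _ ≤ ∑ v : V, #{p ∈ A | v ∈ symmDiff p.1 p.2} :=
        Finset.sum_le_sum_of_subset (Finset.subset_univ _)
    _ = ∑ p ∈ A, #(symmDiff p.1 p.2) := by
        have := Finset.sum_card_bipartiteAbove_eq_sum_card_bipartiteBelow
          (s := (Finset.univ : Finset V)) (t := A) (fun v p => v ∈ symmDiff p.1 p.2)
        simp only [Finset.bipartiteAbove, Finset.bipartiteBelow] at this
        rw [this]
        refine Finset.sum_congr rfl fun p _ => ?_
        congr 1
        ext v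
        simp
    _ ≤ _ := by
        rw [mul_comm]
        exact Finset.sum_le_card_nsmul _ _ _ hd

lemma sum_card_filter_le_card_mul {F P : Type*} [Fintype F] (S : Finset P) (r : F → P → Prop)
    [∀ f p, Decidable (r f p)] {x : ℝ} (h : ∀ p ∈ S, (#{f | r f p} : ℝ) ≤ x) :
    ∑ f, (#{p ∈ S | r f p} : ℝ) ≤ #S * x := by
  have h1 : ∑ f, #{p ∈ S | r f p} = ∑ p ∈ S, #{f | r f p} :=
    Finset.sum_card_bipartiteAbove_eq_sum_card_bipartiteBelow r
  rw [← nsmul_eq_mul]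
  refine le_trans (le_of_eq ?_) (Finset.sum_le_card_nsmul S _ x h)
  exact_mod_cast h1

lemma card_collision_le_div {V : Type*} [Fintype V] [DecidableEq V] {M : ℕ} (hM : 1 ≤ M)
    {e e' : Finset V} (h : e ≠ e') :
    (#{f : V → Bool × Fin M | ∑ v ∈ e, bitLabel M (f v) = ∑ v ∈ e', bitLabel M (f v)} : ℝ) ≤
      (Fintype.card (V → Bool × Fin M) : ℝ) / (2 * M) := by
  have := card_collision_mul_le (bitLabel_injective M) h
  have hM0 : (0 : ℝ) < M := by exact_mod_cast hM
  rw [le_div_iff₀ (by positivity)]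
  rw [Fintype.card_prod, Fintype.card_bool, Fintype.card_fin] at this
  exact_mod_cast this

lemma sum_card_collisions_le {V : Type*} [Fintype V] [DecidableEq V]
    (E : Finset (Finset V)) {C M : ℕ} (hM : 1 ≤ M) (hCM : #E ^ 2 ≤ 4 * C * M) :
    ∑ f : V → Bool × Fin M, (#(collisions E fun v => bitLabel M (f v)) : ℝ) ≤
      2 * C * Fintype.card (V → Bool × Fin M) := by
  have hM0 : (0 : ℝ) < M := by exact_mod_cast hM
  simp only [collisions, ← Finset.filter_filter]
  have h0 := sum_card_filter_le_card_mul {p ∈ E ×ˢ E | p.1 ≠ p.2}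
    (fun (f : V → Bool × Fin M) (p : Finset V × Finset V) =>
      ∑ v ∈ p.1, bitLabel M (f v) = ∑ v ∈ p.2, bitLabel M (f v))
    (fun p hp => card_collision_le_div hM (Finset.mem_filter.1 hp).2)
  refine h0.trans ?_
  have h2 : #{p ∈ E ×ˢ E | p.1 ≠ p.2} ≤ 4 * C * M := by
    have := Finset.card_filter_le (E ×ˢ E) (fun p => p.1 ≠ p.2)
    rw [Finset.card_product, ← sq] at this
    exact this.trans hCM
  have h3 : (#{p ∈ E ×ˢ E | p.1 ≠ p.2} : ℝ) ≤ 4 * C * M := by exact_mod_cast h2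
  calc _ ≤ (4 * C * M : ℝ) * ((Fintype.card (V → Bool × Fin M) : ℝ) / (2 * M)) :=
        mul_le_mul_of_nonneg_right h3 (by positivity)
    _ = _ := by field_simp; ring

/-- At most `#E * 2 ^ #W ≤ #E ^ 2 / (6 * C) ≤ 2 * M / 3` pairs are involved, each colliding with
probability at most `1 / (2 * M)`. -/
lemma sum_card_collisions_filter_subset_le {V : Type*} [Fintype V] [DecidableEq V]
    (E : Finset (Finset V)) (W : Finset V) {C M : ℕ} (hC : 1 ≤ C) (hM : 1 ≤ M)
    (hCM : #E ^ 2 ≤ 4 * C * M) (hE : 6 * C * 2 ^ #W ≤ #E) :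
    ∑ f : V → Bool × Fin M,
      (#{p ∈ collisions E fun v => bitLabel M (f v) | symmDiff p.1 p.2 ⊆ W} : ℝ) ≤
      1 / 3 * Fintype.card (V → Bool × Fin M) := by
  have hM0 : (0 : ℝ) < M := by exact_mod_cast hM
  have hC0 : (0 : ℝ) < C := by exact_mod_cast hC
  have h1 : ∀ f : V → Bool × Fin M,
      {p ∈ collisions E fun v => bitLabel M (f v) | symmDiff p.1 p.2 ⊆ W} =
      {p ∈ {p ∈ {p ∈ E ×ˢ E | symmDiff p.1 p.2 ⊆ W} | p.1 ≠ p.2} |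
        ∑ v ∈ p.1, bitLabel M (f v) = ∑ v ∈ p.2, bitLabel M (f v)} := by
    intro f
    ext p
    simp only [collisions, mem_filter]
    tauto
  simp only [h1]
  have h0 := sum_card_filter_le_card_mul {p ∈ {p ∈ E ×ˢ E | symmDiff p.1 p.2 ⊆ W} | p.1 ≠ p.2}
    (fun (f : V → Bool × Fin M) (p : Finset V × Finset V) =>
      ∑ v ∈ p.1, bitLabel M (f v) = ∑ v ∈ p.2, bitLabel M (f v))
    (fun p hp => card_collision_le_div hM (Finset.mem_filter.1 hp).2)
  refine h0.trans ?_
  have h2 : (#{p ∈ {p ∈ E ×ˢ E | symmDiff p.1 p.2 ⊆ W} | p.1 ≠ p.2} : ℝ) ≤ #E * 2 ^ #W := by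
    exact_mod_cast (Finset.card_filter_le _ _).trans (card_filter_symmDiff_subset_le E W)
  have h3 : (6 * C * 2 ^ #W : ℝ) ≤ #E := by exact_mod_cast hE
  have h4 : (#E : ℝ) ^ 2 ≤ 4 * C * M := by exact_mod_cast hCM
  have h5 : (6 * C : ℝ) * (#E * 2 ^ #W) ≤ (6 * C) * (2 * M / 3) := by nlinarith
  calc _ ≤ (2 * M / 3 : ℝ) * ((Fintype.card (V → Bool × Fin M) : ℝ) / (2 * M)) :=
        mul_le_mul_of_nonneg_right (h2.trans (le_of_mul_le_mul_left h5 (by positivity)))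
          (by positivity)
    _ = _ := by field_simp

lemma sum_card_closePairs_le {V : Type*} [Fintype V] [DecidableEq V]
    (E : Finset (Finset V)) {C M K q : ℕ} (hC : 1 ≤ C)
    (hq : 32 * C * (8 * K + 1) * Nat.centralBinom q ≤ 4 ^ q) :
    ∑ f : V → Bool × Fin M,
      (#(closePairs E {p ∈ E ×ˢ E | #(symmDiff p.1 p.2) < 2 * q} (fun v => bitLabel M (f v))
        (K * (2 * M))) : ℝ) ≤
      (#E : ℝ) ^ 2 * ((Fintype.card (V → Bool × Fin M) : ℝ) / (32 * C)) := by
  have hC0 : (0 : ℝ) < C := by exact_mod_cast hC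
  have h3 : ∀ p ∈ {p ∈ E ×ˢ E | p ∉ {p ∈ E ×ˢ E | #(symmDiff p.1 p.2) < 2 * q}},
      (#{f : V → Bool × Fin M |
        |(∑ v ∈ p.1, (bitLabel M (f v) : ℤ)) - ∑ v ∈ p.2, (bitLabel M (f v) : ℤ)| ≤
        K * (2 * M)} : ℝ) ≤ (Fintype.card (V → Bool × Fin M) : ℝ) / (32 * C) := by
    intro p hp
    have hpq : 2 * q ≤ #(symmDiff p.1 p.2) := by
      simp only [mem_filter] at hp
      by_contra hlt
      exact hp.2 ⟨hp.1, by omega⟩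
    have h := card_close_mul_le (M := M) K p.1 p.2 hpq
    set X := #{f : V → Bool × Fin M |
      |(∑ v ∈ p.1, (bitLabel M (f v) : ℤ)) - ∑ v ∈ p.2, (bitLabel M (f v) : ℤ)| ≤
        K * (2 * M)} with hX
    have h'' : X * (32 * C) * 4 ^ q ≤ Fintype.card (V → Bool × Fin M) * 4 ^ q := by
      calc X * (32 * C) * 4 ^ q = (X * 4 ^ q) * (32 * C) := by ring
        _ ≤ _ := Nat.mul_le_mul_right _ h
        _ = (32 * C * (8 * K + 1) * Nat.centralBinom q) *
          Fintype.card (V → Bool × Fin M) := by ring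
        _ ≤ 4 ^ q * Fintype.card (V → Bool × Fin M) := Nat.mul_le_mul_right _ hq
        _ = _ := by ring
    have h3 := Nat.le_of_mul_le_mul_right h'' (by positivity)
    rw [le_div_iff₀ (by positivity)]
    exact_mod_cast h3
  simp only [closePairs, ← Finset.filter_filter]
  have h0 := sum_card_filter_le_card_mul
    {p ∈ E ×ˢ E | p ∉ {p ∈ E ×ˢ E | #(symmDiff p.1 p.2) < 2 * q}}
    (fun (f : V → Bool × Fin M) (p : Finset V × Finset V) => |(∑ v ∈ p.1, (bitLabel M (f v) : ℤ)) - ∑ v ∈ p.2, (bitLabel M (f v) : ℤ)| ≤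
      K * (2 * M)) h3
  refine h0.trans ?_
  refine mul_le_mul_of_nonneg_right ?_ (by positivity)
  have := Finset.card_filter_le (E ×ˢ E)
    (fun p => p ∉ {p ∈ E ×ˢ E | #(symmDiff p.1 p.2) < 2 * q})
  rw [Finset.card_product] at this
  rw [sq]
  exact_mod_cast this

/-- A random labeling has few collisions, none of them inside `W`, and few close pairs. -/
lemma exists_labeling_card_collisions_le {V : Type*} [Fintype V] [DecidableEq V]
    (E : Finset (Finset V)) (W : Finset V) {C M q : ℕ} (hC : 1 ≤ C) (hM : 1 ≤ M)
    (hCM : #E ^ 2 ≤ 4 * C * M) (hE : 6 * C * 2 ^ #W ≤ #E)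
    (hq : 32 * C * (8 * (6 * C + 1) + 1) * Nat.centralBinom q ≤ 4 ^ q) :
    ∃ f : V → ℕ, (∀ v, f v ∈ Finset.Icc 1 (2 * M)) ∧
      (∀ p ∈ collisions E f, ¬ symmDiff p.1 p.2 ⊆ W) ∧
      #(collisions E f) ≤ 6 * C ∧
      #(closePairs E {p ∈ E ×ˢ E | #(symmDiff p.1 p.2) < 2 * q} f
        ((6 * C + 1 : ℕ) * (2 * M))) * (8 * C) ≤ #E ^ 2 := by
  have hEpos : 0 < #E := lt_of_lt_of_le (by positivity) hE
  have hC0 : (0 : ℝ) < C := by exact_mod_cast hC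
  have hE0 : (0 : ℝ) < #E := by exact_mod_cast hEpos
  have : Nonempty (Fin M) := ⟨⟨0, hM⟩⟩
  have hΩpos : (0 : ℝ) < Fintype.card (V → Bool × Fin M) := by exact_mod_cast Fintype.card_pos
  have hcoll := sum_card_collisions_le E hM hCM
  have hwc := sum_card_collisions_filter_subset_le E W hC hM hCM hE
  have hcl := sum_card_closePairs_le (M := M) E hC hq
  generalize hx : (fun f : V → Bool × Fin M =>
    (#(collisions E fun v => bitLabel M (f v)) : ℝ)) = x at hcoll
  generalize hy : (fun f : V → Bool × Fin M =>
    (#{p ∈ collisions E fun v => bitLabel M (f v) | symmDiff p.1 p.2 ⊆ W} : ℝ)) = y at hwc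
  generalize hz : (fun f : V → Bool × Fin M =>
    (#(closePairs E {p ∈ E ×ˢ E | #(symmDiff p.1 p.2) < 2 * q} (fun v => bitLabel M (f v))
        ((6 * C + 1 : ℕ) * (2 * M))) : ℝ)) = z at hcl
  -- Markov and union bound in one sum: the normalized means are at most `1/3`, `1/3` and `1/4`, so
  -- some labeling makes all three terms less than one at once.
  have hsum : ∑ f, (x f / (6 * C) + y f + z f * (8 * C / (#E : ℝ) ^ 2)) <
      ∑ _f : V → Bool × Fin M, (1 : ℝ) := by
    rw [Finset.sum_add_distrib, Finset.sum_add_distrib, ← Finset.sum_div, ← Finset.sum_mul,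
      Finset.sum_const, Finset.card_univ, nsmul_eq_mul, mul_one]
    have h1 : (∑ f, x f) / (6 * C) ≤ 1 / 3 * Fintype.card (V → Bool × Fin M) := by
      rw [div_le_iff₀ (by positivity)]
      linarith
    have h2 : (∑ f, z f) * (8 * C / (#E : ℝ) ^ 2) ≤ 1 / 4 * Fintype.card (V → Bool × Fin M) := by
      calc _ ≤ _ := mul_le_mul_of_nonneg_right hcl (by positivity)
        _ = _ := by field_simp; norm_num
    linarith
  obtain ⟨f, -, hf⟩ := Finset.exists_lt_of_sum_lt hsum
  rw [← hx, ← hy, ← hz] at hf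
  dsimp only at hf
  have p1 : (0 : ℝ) ≤ (#(collisions E fun v => bitLabel M (f v)) : ℝ) / (6 * C) := by positivity
  have p2 : (0 : ℝ) ≤ (#{p ∈ collisions E fun v => bitLabel M (f v) |
    symmDiff p.1 p.2 ⊆ W} : ℝ) := by positivity
  have p3 : (0 : ℝ) ≤ (#(closePairs E {p ∈ E ×ˢ E | #(symmDiff p.1 p.2) < 2 * q}
    (fun v => bitLabel M (f v)) ((6 * C + 1 : ℕ) * (2 * M))) : ℝ) * (8 * C / (#E : ℝ) ^ 2) := by
    positivity
  refine ⟨fun v => bitLabel M (f v),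
    fun v => Finset.mem_Icc.2 ⟨one_le_bitLabel _, bitLabel_le _⟩, ?_, ?_, ?_⟩
  · intro p hp hpW
    have h1 : (#{p ∈ collisions E fun v => bitLabel M (f v) | symmDiff p.1 p.2 ⊆ W} : ℝ) < 1 := by
      linarith
    have h2 : #{p ∈ collisions E fun v => bitLabel M (f v) | symmDiff p.1 p.2 ⊆ W} = 0 :=
      Nat.lt_one_iff.1 (by exact_mod_cast h1)
    exact (Finset.filter_eq_empty_iff.1 (Finset.card_eq_zero.1 h2)) hp hpW
  · have h1 : (#(collisions E fun v => bitLabel M (f v)) : ℝ) / (6 * C) ≤ 1 := by linarith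
    rw [div_le_one (by positivity)] at h1
    exact_mod_cast h1
  · have h1 : (#(closePairs E {p ∈ E ×ˢ E | #(symmDiff p.1 p.2) < 2 * q}
      (fun v => bitLabel M (f v)) ((6 * C + 1 : ℕ) * (2 * M))) : ℝ) *
        (8 * C / (#E : ℝ) ^ 2) ≤ 1 := by linarith
    rw [← mul_div_assoc, div_le_one (by positivity)] at h1
    exact_mod_cast h1

/-- Every sufficiently large set family can be sum-distinguished with labels at most `#E ^ 2 / C`. -/
lemma exists_labeling_collisions_eq_empty {C : ℕ} (hC : 1 ≤ C) :
    ∃ m₀ : ℕ, ∀ {V : Type} [Fintype V] [DecidableEq V] (E : Finset (Finset V)), m₀ ≤ #E →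
      ∃ g : V → ℕ, (∀ v, 1 ≤ g v ∧ g v * C ≤ #E ^ 2) ∧ collisions E g = ∅ := by
  obtain ⟨q, hq⟩ := exists_mul_centralBinom_le (32 * C * (8 * (6 * C + 1) + 1))
  refine ⟨6 * C * 2 ^ (16 * C * q), fun {V} _ _ E hE => ?_⟩
  have hE6 : 6 * C ≤ #E := le_trans (Nat.le_mul_of_pos_right _ (by positivity)) hE
  -- The largest `M` for which labels up to `2 * M` meet the bound `#E ^ 2 / C`.
  set M := #E ^ 2 / (2 * C) with hM
  have hM1 : 2 * C * M ≤ #E ^ 2 := Nat.mul_div_le _ _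
  have hM2 : #E ^ 2 < 2 * C * M + 2 * C := by
    have := Nat.lt_mul_div_succ (#E ^ 2) (show 0 < 2 * C by omega)
    rw [← hM] at this
    linarith
  have hMpos : 1 ≤ M := by
    by_contra h0
    rw [Nat.lt_one_iff.1 (not_le.1 h0)] at hM2
    nlinarith
  have hCM : #E ^ 2 ≤ 4 * C * M := by nlinarith
  set A := {p ∈ E ×ˢ E | #(symmDiff p.1 p.2) < 2 * q} with hA
  set a := #E ^ 2 / (8 * C) with ha
  set W : Finset V := {v : V | a < #{p ∈ A | v ∈ symmDiff p.1 p.2}} with hWdef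
  have hAE : #A ≤ #E ^ 2 := by
    rw [sq, ← Finset.card_product]
    exact Finset.card_filter_le _ _
  have hWcard : #W ≤ 16 * C * q := by
    have h1 := card_heavy_mul_le A (d := 2 * q) (fun p hp => (Finset.mem_filter.1 hp).2.le) a
    rw [← hWdef] at h1
    have h2 : #E ^ 2 < 8 * C * (a + 1) := Nat.lt_mul_div_succ _ (by omega)
    have h3 : #W * (a + 1) ≤ (16 * C * q) * (a + 1) := by
      calc _ ≤ 2 * q * #A := h1
        _ ≤ 2 * q * (8 * C * (a + 1)) := Nat.mul_le_mul_left _ (hAE.trans h2.le)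
        _ = _ := by ring
    exact Nat.le_of_mul_le_mul_right h3 a.succ_pos
  obtain ⟨f, hf1, hf2, hf3, hf4⟩ := exists_labeling_card_collisions_le E W hC hMpos hCM
    (le_trans (Nat.mul_le_mul_left _ (Nat.pow_le_pow_right (by norm_num) hWcard)) hE) hq
  -- Small and close pairs each forbid at most `#E ^ 2 / (8 * C)` labels, together at most `M`.
  have hab : a + a < 2 * M := by
    have : a * (8 * C) ≤ #E ^ 2 := Nat.div_mul_le_self _ _
    have h1 : (2 * a) * C ≤ M * C := by nlinarith
    have := Nat.le_of_mul_le_mul_right h1 (by omega)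
    omega
  obtain ⟨g, hg, hg'⟩ := exists_labeling_of_card_collisions_le E A W hab
    (fun v hv => by simpa [hWdef] using hv) (6 * C) f hf1 hf2 hf3
    ((Nat.le_div_iff_mul_le (by omega)).2 (by push_cast at hf4 ⊢; exact hf4))
  refine ⟨g, fun v => ?_, hg'⟩
  have := Finset.mem_Icc.1 (hg v)
  exact ⟨this.1, by nlinarith⟩

/-! ### Counting the families separated by one labeling -/

open Classical in
/-- The `m`-element subfamilies of `P` on which `σ` is injective. -/
noncomputable def separatedFamilies {α : Type*} (P : Finset α) (σ : α → ℕ) (m : ℕ) :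
    Finset (Finset α) :=
  {F ∈ P.powersetCard m | Set.InjOn σ (F : Set α)}

lemma mem_separatedFamilies {α : Type*} {P : Finset α} {σ : α → ℕ} {m : ℕ} {F : Finset α} :
    F ∈ separatedFamilies P σ m ↔ F ∈ P.powersetCard m ∧ Set.InjOn σ (F : Set α) := by
  simp [separatedFamilies]

lemma card_separatedFamilies_image_eq_le {α : Type*} [DecidableEq α] (P : Finset α) (σ : α → ℕ)
    (m : ℕ) (T : Finset ℕ) :
    #{F ∈ separatedFamilies P σ m | F.image σ = T} ≤
      ∏ s ∈ T, #{e ∈ P | σ e = s} := by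
  classical
  rw [← Finset.card_pi T (fun s => {e ∈ P | σ e = s})]
  refine (Finset.card_le_card ?_).trans (Finset.card_image_le
    (f := fun φ => T.attach.image (fun s => φ s.1 s.2)))
  intro F hF
  simp only [mem_filter, mem_separatedFamilies, mem_powersetCard] at hF
  obtain ⟨⟨⟨hFP, -⟩, hinj⟩, rfl⟩ := hF
  have hex : ∀ s ∈ F.image σ, ∃ e ∈ F, σ e = s := fun s hs => by simpa using hs
  choose φ hφF hφ using hex
  rw [Finset.mem_image]
  refine ⟨φ, ?_, ?_⟩
  · rw [Finset.mem_pi]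
    exact fun s hs => Finset.mem_filter.2 ⟨hFP (hφF s hs), hφ s hs⟩
  · ext e
    simp only [mem_image, mem_attach, true_and, Subtype.exists]
    constructor
    · rintro ⟨s, hs, rfl⟩
      exact hφF s (Finset.mem_image.2 hs)
    · intro he
      have hs : σ e ∈ F.image σ := Finset.mem_image_of_mem _ he
      exact ⟨σ e, Finset.mem_image.1 hs, hinj (hφF _ hs) he (hφ _ hs)⟩

/-- A separated family picks one element from each of `m` fibres of `σ`, so the count is at most the
`m`-th elementary symmetric polynomial of the fibre sizes, one coefficient of the generating
product. -/
lemma card_separatedFamilies_mul_pow_le {α : Type*} [DecidableEq α] (P : Finset α) (σ : α → ℕ)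
    (S : Finset ℕ) (hσ : ∀ e ∈ P, σ e ∈ S) (m : ℕ) {x : ℝ} (hx : 0 ≤ x) :
    (#(separatedFamilies P σ m) : ℝ) * x ^ m ≤
      ∏ s ∈ S, (1 + x * #{e ∈ P | σ e = s}) := by
  have hmaps : ∀ F ∈ separatedFamilies P σ m, F.image σ ∈ S.powersetCard m := by
    intro F hF
    simp only [mem_separatedFamilies, mem_powersetCard] at hF ⊢
    refine ⟨fun s hs => ?_, ?_⟩
    · obtain ⟨e, he, rfl⟩ := Finset.mem_image.1 hs
      exact hσ e (hF.1.1 he)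
    · rw [Finset.card_image_of_injOn hF.2, hF.1.2]
  rw [Finset.card_eq_sum_card_fiberwise hmaps, Nat.cast_sum, Finset.sum_mul]
  calc _ ≤ ∑ T ∈ S.powersetCard m, ∏ s ∈ T, (x * #{e ∈ P | σ e = s}) := by
        refine Finset.sum_le_sum fun T hT => ?_
        rw [Finset.prod_mul_distrib, Finset.prod_const, (Finset.mem_powersetCard.1 hT).2,
          mul_comm]
        refine mul_le_mul_of_nonneg_left ?_ (by positivity)
        exact_mod_cast card_separatedFamilies_image_eq_le P σ m T
    _ ≤ ∑ T ∈ S.powerset, ∏ s ∈ T, (x * #{e ∈ P | σ e = s}) := by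
        refine Finset.sum_le_sum_of_subset_of_nonneg ?_ fun T _ _ => by positivity
        intro T hT
        exact Finset.mem_powerset.2 (Finset.mem_powersetCard.1 hT).1
    _ = _ := (Finset.prod_one_add S).symm

/-- Equal fibres are the worst case. Bounding each factor by `(1 + t) * exp ((y - t) / (1 + t))`
suffices, because the exponents sum to zero. -/
lemma prod_one_add_le_pow {ι : Type*} (S : Finset ι) (y : ι → ℝ) {t : ℝ} (ht : 0 ≤ t)
    (hy : ∀ s ∈ S, 0 ≤ y s) (hsum : ∑ s ∈ S, y s = #S * t) :
    ∏ s ∈ S, (1 + y s) ≤ (1 + t) ^ #S := by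
  have ht' : (0 : ℝ) < 1 + t := by linarith
  calc ∏ s ∈ S, (1 + y s) ≤ ∏ s ∈ S, ((1 + t) * Real.exp ((y s - t) / (1 + t))) := by
        refine Finset.prod_le_prod (fun s hs => by linarith [hy s hs]) fun s _ => ?_
        calc 1 + y s = (1 + t) * ((y s - t) / (1 + t) + 1) := by field_simp; ring
          _ ≤ _ := mul_le_mul_of_nonneg_left (Real.add_one_le_exp _) ht'.le
    _ = _ := by
        rw [Finset.prod_mul_distrib, Finset.prod_const, ← Real.exp_sum, ← Finset.sum_div,
          Finset.sum_sub_distrib, hsum]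
        simp

lemma one_add_le_exp_sub_sq {t : ℝ} (h0 : 0 ≤ t) (h1 : t ≤ 1) :
    1 + t ≤ Real.exp (t - t ^ 2 / 4) := by
  have hy : 0 ≤ t - t ^ 2 / 4 := by nlinarith
  refine le_trans ?_ (Real.quadratic_le_exp_of_nonneg hy)
  have : 1 / 2 ≤ (1 - t / 4) ^ 2 := by nlinarith
  nlinarith [mul_le_mul_of_nonneg_left this (sq_nonneg t)]

/-- Few `m`-element subfamilies of `P` are separated by a function with few values. -/
lemma card_separatedFamilies_le {α : Type*} [DecidableEq α] (P : Finset α) (σ : α → ℕ)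
    (S : Finset ℕ) (hσ : ∀ e ∈ P, σ e ∈ S) {m : ℕ} (hm : 1 ≤ m) (hmS : m ≤ #S) (hP : 1 ≤ #P) :
    (#(separatedFamilies P σ m) : ℝ) ≤
      ((#P : ℝ) / m) ^ m * Real.exp (m - (m : ℝ) ^ 2 / (4 * #S)) := by
  have hm0 : (0 : ℝ) < m := by exact_mod_cast hm
  have hP0 : (0 : ℝ) < #P := by exact_mod_cast hP
  have hS0 : (0 : ℝ) < #S := by exact_mod_cast hm.trans hmS
  -- This `x` makes the weighted fibre sizes sum to `m`, so their mean is `m / #S ≤ 1`.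
  have h1 := card_separatedFamilies_mul_pow_le P σ S hσ m (x := (m : ℝ) / #P) (by positivity)
  have hsum : ∑ s ∈ S, (m : ℝ) / #P * #{e ∈ P | σ e = s} = #S * ((m : ℝ) / #S) := by
    rw [← Finset.mul_sum, ← Nat.cast_sum, ← Finset.card_eq_sum_card_fiberwise hσ]
    field_simp
  have h2 := prod_one_add_le_pow S _ (t := (m : ℝ) / #S) (by positivity)
    (fun s _ => by positivity) hsum
  have h3 : (1 + (m : ℝ) / #S) ^ #S ≤ Real.exp (m - (m : ℝ) ^ 2 / (4 * #S)) := by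
    calc _ ≤ Real.exp ((m : ℝ) / #S - ((m : ℝ) / #S) ^ 2 / 4) ^ #S := by
          refine pow_le_pow_left₀ (by positivity) (one_add_le_exp_sub_sq (by positivity) ?_) _
          rw [div_le_one hS0]
          exact_mod_cast hmS
      _ = _ := by
          rw [← Real.exp_nat_mul]
          congr 1
          field_simp
  have h4 := h1.trans (h2.trans h3)
  rw [← le_div_iff₀ (by positivity)] at h4
  refine h4.trans (le_of_eq ?_)
  rw [div_eq_mul_inv, ← inv_pow, inv_div, mul_comm]

/-- A weak Stirling bound; the inductive step is `(1 + 1 / m) ^ (m + 1) ≥ e`. The polynomial loss `3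
* m` is harmless against the exponential saving. -/
lemma factorial_mul_exp_le (m : ℕ) (hm : 1 ≤ m) :
    (m.factorial : ℝ) * Real.exp m ≤ 3 * m * (m : ℝ) ^ m := by
  induction m, hm using Nat.le_induction with
  | base => simpa using Real.exp_one_lt_three.le
  | succ m hm ih =>
    have hm0 : (0 : ℝ) < m := by exact_mod_cast hm
    have h1 : (m : ℝ) / (m + 1) ≤ Real.exp (-1 / (m + 1)) := by
      refine le_trans (le_of_eq ?_) (Real.add_one_le_exp _)
      field_simp
      ring
    have h2 : ((m : ℝ) / (m + 1)) ^ (m + 1) ≤ Real.exp (-1) := by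
      calc _ ≤ Real.exp (-1 / (m + 1)) ^ (m + 1) := pow_le_pow_left₀ (by positivity) h1 _
        _ = _ := by
          rw [← Real.exp_nat_mul]
          congr 1
          push_cast
          field_simp
    have h3 : (m : ℝ) ^ (m + 1) * Real.exp 1 ≤ (m + 1 : ℝ) ^ (m + 1) := by
      rw [div_pow, div_le_iff₀ (by positivity)] at h2
      calc _ ≤ (Real.exp (-1) * (m + 1) ^ (m + 1)) * Real.exp 1 :=
            mul_le_mul_of_nonneg_right h2 (Real.exp_pos _).le
        _ = (Real.exp (-1) * Real.exp 1) * (m + 1) ^ (m + 1) := by ring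
        _ = _ := by rw [← Real.exp_add]; simp
    rw [Nat.factorial_succ]
    push_cast
    rw [Real.exp_add]
    calc ((m : ℝ) + 1) * m.factorial * (Real.exp m * Real.exp 1)
        = (m + 1) * Real.exp 1 * (m.factorial * Real.exp m) := by ring
      _ ≤ (m + 1) * Real.exp 1 * (3 * m * (m : ℝ) ^ m) :=
          mul_le_mul_of_nonneg_left ih (by positivity)
      _ = 3 * (m + 1) * ((m : ℝ) ^ (m + 1) * Real.exp 1) := by ring
      _ ≤ _ := mul_le_mul_of_nonneg_left h3 (by positivity)

lemma pow_le_two_mul_factorial_mul_choose {M m : ℕ} (hm : 1 ≤ m) (hM : 2 * m ^ 2 ≤ M) :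
    (M : ℝ) ^ m ≤ 2 * m.factorial * M.choose m := by
  have hm0 : (0 : ℝ) < m := by exact_mod_cast hm
  have hM' : (2 * m ^ 2 : ℝ) ≤ M := by exact_mod_cast hM
  have hM0 : (0 : ℝ) < M := lt_of_lt_of_le (by positivity) hM'
  have hmM : m ≤ M := by nlinarith
  have h1 : (M - m) ^ m ≤ m.factorial * M.choose m := by
    rw [← Nat.descFactorial_eq_factorial_mul_choose]
    exact (Nat.pow_le_pow_left (by omega) _).trans (Nat.pow_sub_le_descFactorial M m)
  have h2 : ((M : ℝ) - m) ^ m ≤ m.factorial * M.choose m := by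
    rw [← Nat.cast_sub hmM]
    exact_mod_cast h1
  have h3 : (1 : ℝ) / 2 ≤ (1 + -((m : ℝ) / M)) ^ m := by
    have h5 : (m : ℝ) / M ≤ 1 := by
      rw [div_le_one hM0]
      exact_mod_cast hmM
    refine le_trans ?_ (one_add_mul_le_pow (by linarith) m)
    have : (m : ℝ) * ((m : ℝ) / M) ≤ 1 / 2 := by
      rw [mul_div_assoc', div_le_iff₀ hM0]
      nlinarith
    linarith
  have h4 : ((M : ℝ) - m) ^ m = M ^ m * (1 + -((m : ℝ) / M)) ^ m := by
    rw [← mul_pow]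
    congr 1
    field_simp
    ring
  have h5 : (M : ℝ) ^ m * (1 / 2) ≤ M ^ m * (1 + -((m : ℝ) / M)) ^ m :=
    mul_le_mul_of_nonneg_left h3 (by positivity)
  linarith

/-- Some family of `m` sets of size `k` inside `U` is not sum-distinguished by any labeling with
labels at most `N`. -/
lemma exists_family_not_injOn {V : Type*} [Fintype V] [DecidableEq V] (U : Finset V)
    {k N m : ℕ} (hk : 1 ≤ k) (hm : 1 ≤ m) (hmN : m ≤ k * N)
    (hM : 2 * m ^ 2 ≤ (#U).choose k)
    (hexp : 6 * m * (N : ℝ) ^ #U < Real.exp ((m : ℝ) ^ 2 / (4 * (k * N : ℕ)))) :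
    ∃ F ∈ (U.powersetCard k).powersetCard m, ∀ f : V → ℕ, (∀ v, f v ∈ Finset.Icc 1 N) →
      ¬ Set.InjOn (fun e : Finset V => ∑ v ∈ e, f v) F := by
  by_contra! hcon
  have hN : 1 ≤ N := by
    by_contra h0
    simp [Nat.lt_one_iff.1 (not_le.1 h0)] at hmN
    omega
  set P := U.powersetCard k with hP
  have hPcard : #P = (#U).choose k := Finset.card_powersetCard _ _
  -- Labels outside `U` affect no sum, so they are frozen at 1 and the union bound pays only `N ^
  -- #U`.
  let L : Finset (V → ℕ) := Fintype.piFinset fun v => if v ∈ U then Finset.Icc 1 N else {1}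
  have hLcard : #L = N ^ #U := by
    rw [Fintype.card_piFinset]
    have : ∀ v, #(if v ∈ U then Finset.Icc 1 N else {1}) = if v ∈ U then N else 1 := by
      intro v
      split_ifs <;> simp
    simp only [this]
    rw [Finset.prod_ite_mem]
    simp
  have hsub : P.powersetCard m ⊆ L.biUnion fun g =>
      separatedFamilies P (fun e : Finset V => ∑ v ∈ e, g v) m := by
    intro F hF
    obtain ⟨f, hf, hinj⟩ := hcon F hF
    rw [Finset.mem_biUnion]
    refine ⟨fun v => if v ∈ U then f v else 1, ?_, ?_⟩
    · rw [Fintype.mem_piFinset]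
      intro v
      have := hf v
      split_ifs <;> simp_all
    · rw [mem_separatedFamilies]
      refine ⟨hF, Set.InjOn.congr hinj fun e he => ?_⟩
      have heU : e ⊆ U := (Finset.mem_powersetCard.1 ((Finset.mem_powersetCard.1 hF).1 he)).1
      exact Finset.sum_congr rfl fun v hv => by simp [heU hv]
  have hone : ∀ g ∈ L,
      (#(separatedFamilies P (fun e : Finset V => ∑ v ∈ e, g v) m) : ℝ) ≤
      ((#P : ℝ) / m) ^ m * Real.exp (m - (m : ℝ) ^ 2 / (4 * (k * N : ℕ))) := by
    intro g hg
    have hS : #(Finset.Icc 1 (k * N)) = k * N := by simp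
    have := card_separatedFamilies_le P (fun e : Finset V => ∑ v ∈ e, g v) (Finset.Icc 1 (k * N)) ?_ hm
      (by rw [hS]; exact hmN) (by nlinarith)
    · rwa [hS] at this
    · intro e he
      obtain ⟨heU, hek⟩ := Finset.mem_powersetCard.1 he
      have hgv : ∀ v ∈ e, 1 ≤ g v ∧ g v ≤ N := fun v hv => by
        have := Fintype.mem_piFinset.1 hg v
        simpa [heU hv] using this
      rw [Finset.mem_Icc]
      constructor
      · refine hk.trans ?_
        have := Finset.card_nsmul_le_sum e g 1 fun v hv => (hgv v hv).1
        simpa [hek] using this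
      · have := Finset.sum_le_card_nsmul e g N fun v hv => (hgv v hv).2
        simpa [hek] using this
  have hcount : ((#P).choose m : ℝ) ≤
      (N : ℝ) ^ #U * (((#P : ℝ) / m) ^ m * Real.exp (m - (m : ℝ) ^ 2 / (4 * (k * N : ℕ)))) := by
    have h1 := (Finset.card_le_card hsub).trans Finset.card_biUnion_le
    rw [Finset.card_powersetCard] at h1
    calc ((#P).choose m : ℝ) ≤ ∑ g ∈ L,
          (#(separatedFamilies P (fun e : Finset V => ∑ v ∈ e, g v) m) : ℝ) := by
          exact_mod_cast h1
      _ ≤ _ := Finset.sum_le_card_nsmul _ _ _ hone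
      _ = _ := by rw [nsmul_eq_mul, hLcard]; push_cast; rfl
  have hm0 : (0 : ℝ) < m := by exact_mod_cast hm
  have hP0 : (0 : ℝ) < #P := by
    have : 0 < #P := by rw [hPcard]; nlinarith
    exact_mod_cast this
  have hlow := pow_le_two_mul_factorial_mul_choose hm (hPcard ▸ hM)
  have hfac := factorial_mul_exp_le m hm
  set D := (m : ℝ) ^ 2 / (4 * (k * N : ℕ)) with hD
  have hfin : (#P : ℝ) ^ m * Real.exp D ≤ (#P : ℝ) ^ m * (6 * m * (N : ℝ) ^ #U) := by
    have hE : Real.exp ((m : ℝ) - D) * Real.exp D = Real.exp m := by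
      rw [← Real.exp_add]; simp
    calc (#P : ℝ) ^ m * Real.exp D
        ≤ (2 * m.factorial * ((N : ℝ) ^ #U * (((#P : ℝ) / m) ^ m * Real.exp (m - D)))) *
          Real.exp D := by
          refine mul_le_mul_of_nonneg_right (hlow.trans ?_) (Real.exp_pos _).le
          exact mul_le_mul_of_nonneg_left hcount (by positivity)
      _ = 2 * (N : ℝ) ^ #U * ((#P : ℝ) / m) ^ m *
          (m.factorial * (Real.exp (m - D) * Real.exp D)) := by ring
      _ ≤ 2 * (N : ℝ) ^ #U * ((#P : ℝ) / m) ^ m * (3 * m * (m : ℝ) ^ m) := by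
          rw [hE]
          exact mul_le_mul_of_nonneg_left hfac (by positivity)
      _ = _ := by rw [div_pow]; field_simp; ring
  exact absurd (le_of_mul_le_mul_left hfin (by positivity)) (not_le.2 hexp)

/-! ### Transfer to hypergraphs -/

lemma Hypergraph.labelSum_coe {α : Type*} (f : α → ℕ) (e : Finset α) :
    Hypergraph.labelSum f (e : Set α) = ∑ v ∈ e, f v := by
  rw [Hypergraph.labelSum, finsum_mem_coe_finset]

lemma exists_sumDistValues_mul_le {C : ℕ} (hC : 1 ≤ C) :
    ∃ m₀ : ℕ, ∀ n m : ℕ, m₀ ≤ m → ∀ k ∈ Hypergraph.sumDistValues n m, k * C ≤ m ^ 2 := by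
  classical
  obtain ⟨m₀, h₀⟩ := exists_labeling_collisions_eq_empty hC
  refine ⟨m₀, fun n m hm k hk => ?_⟩
  obtain ⟨H, -, -, hcard, rfl⟩ := hk
  let E : Finset (Finset (Fin n)) := {e | (e : Set (Fin n)) ∈ H.edgeSet}
  have hE : #E = m := by
    rw [← hcard, ← Set.ncard_coe_finset]
    refine Set.ncard_congr (fun e _ => (e : Set (Fin n))) ?_ ?_ ?_
    · intro e he
      simpa [E] using he
    · intro e e' _ _ h
      exact Finset.coe_injective h
    · intro s hs
      exact ⟨s.toFinset, by simpa [E] using hs, by simp⟩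
  obtain ⟨g, hg, hcol⟩ := h₀ E (hE.symm ▸ hm)
  rw [hE] at hg
  rw [← Nat.le_div_iff_mul_le (by omega)]
  refine Nat.sInf_le ⟨g, ⟨fun v _ => (hg v).1, ?_⟩, fun v _ =>
    (Nat.le_div_iff_mul_le (by omega)).2 (hg v).2⟩
  intro e he e' he' hne hsum
  have : (e.toFinset, e'.toFinset) ∈ collisions E g := by
    simp only [collisions, mem_filter, mem_product]
    refine ⟨⟨by simpa [E] using he, by simpa [E] using he'⟩, ?_, ?_⟩
    · simpa using hne
    · rw [← Hypergraph.labelSum_coe, ← Hypergraph.labelSum_coe]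
      simpa using hsum
  simp [hcol] at this

lemma exists_mem_sumDistValues_lt {n k N m : ℕ} (U : Finset (Fin n)) (hk : 1 ≤ k) (hm : 1 ≤ m)
    (hmN : m ≤ k * N) (hM : 2 * m ^ 2 ≤ (#U).choose k)
    (hexp : 6 * m * (N : ℝ) ^ #U < Real.exp ((m : ℝ) ^ 2 / (4 * (k * N : ℕ)))) :
    ∃ x ∈ Hypergraph.sumDistValues n m, N < x := by
  obtain ⟨F, hF, hFf⟩ := exists_family_not_injOn U hk hm hmN hM hexp
  obtain ⟨hFU, hFm⟩ := Finset.mem_powersetCard.1 hF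
  let H : Hypergraph (Fin n) :=
    ⟨Set.univ, (fun e : Finset (Fin n) => (e : Set (Fin n))) '' F, fun _ _ => Set.subset_univ _⟩
  refine ⟨H.sumDistNumber, ⟨H, rfl, ?_, ?_, rfl⟩, ?_⟩
  · rintro ⟨e, he, h0⟩
    have h1 := (Finset.mem_powersetCard.1 (hFU he)).2
    simp only [Finset.coe_eq_empty] at h0
    simp [h0] at h1
    omega
  · change ((fun e : Finset (Fin n) => (e : Set (Fin n))) '' F).ncard = m
    rw [Set.ncard_image_of_injective _ Finset.coe_injective, Set.ncard_coe_finset, hFm]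
  · by_contra! hle
    obtain ⟨f, ⟨hpos, hdist⟩, hbd⟩ := (Hypergraph.isLeast_sumDistNumber H).1
    refine hFf f (fun v => Finset.mem_Icc.2
      ⟨hpos v (Set.mem_univ _), (hbd v (Set.mem_univ _)).trans hle⟩) ?_
    intro e he e' he' hee
    by_contra hne
    refine hdist e ⟨e, he, rfl⟩ e' ⟨e', he', rfl⟩ (fun h => hne (Finset.coe_injective h)) ?_
    rw [Hypergraph.labelSum_coe, Hypergraph.labelSum_coe]
    exact hee

/-! ### Parameters of the lower bound -/

lemma pow_le_mul_choose {n k : ℕ} (h : 2 * k ≤ n) :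
    n ^ k ≤ 2 ^ k * k.factorial * n.choose k := by
  calc n ^ k ≤ (2 * (n + 1 - k)) ^ k := Nat.pow_le_pow_left (by omega) _
    _ = 2 ^ k * (n + 1 - k) ^ k := mul_pow _ _ _
    _ ≤ 2 ^ k * n.descFactorial k := Nat.mul_le_mul_left _ (Nat.pow_sub_le_descFactorial n k)
    _ = _ := by rw [Nat.descFactorial_eq_factorial_mul_choose, mul_assoc]

-- With `k ≥ 6 / ε`, `#U ^ k ≥ m ^ 3` leaves room for `2 * m ^ 2` sets. Writing `y = m ^ (ε / 4) ≥
-- log m`, the entropy of the labelings is at most `6 * y ^ 3` while the exponent saved is at least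
-- `y ^ 4 / (4 * k)`; hence the threshold `24 * k + 1` for `y`.
open Filter in
lemma eventually_parameters {ε : ℝ} (hε : 0 < ε) (hε1 : ε ≤ 1) {k : ℕ} (hk : 6 / ε ≤ k) :
    ∀ᶠ m : ℕ in atTop, 1 ≤ m ∧ m ≤ k * ⌊(m : ℝ) ^ (2 - ε)⌋₊ ∧
      2 * m ^ 2 ≤ (⌈(m : ℝ) ^ (ε / 2)⌉₊).choose k ∧
      6 * m * (⌊(m : ℝ) ^ (2 - ε)⌋₊ : ℝ) ^ ⌈(m : ℝ) ^ (ε / 2)⌉₊ <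
        Real.exp ((m : ℝ) ^ 2 / (4 * (k * ⌊(m : ℝ) ^ (2 - ε)⌋₊ : ℕ))) := by
  have hlog : ∀ᶠ x : ℝ in atTop, Real.log x ≤ x ^ (ε / 4) := by
    have := (isLittleO_log_rpow_atTop (show 0 < ε / 4 by positivity)).bound one_pos
    filter_upwards [this, eventually_ge_atTop 1] with x hx h1
    rw [one_mul, Real.norm_of_nonneg (Real.log_nonneg h1),
      Real.norm_of_nonneg (by positivity)] at hx
    exact hx
  have hbig : ∀ᶠ x : ℝ in atTop, (24 * k + 1 : ℝ) ≤ x ^ (ε / 4) :=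
    (tendsto_rpow_atTop (show 0 < ε / 4 by positivity)).eventually_ge_atTop _
  have hcast := tendsto_natCast_atTop_atTop (R := ℝ)
  filter_upwards [hcast.eventually hlog, hcast.eventually hbig, eventually_ge_atTop 6,
    eventually_ge_atTop (2 * (2 ^ k * k.factorial))] with m hmlog hmbig hm6 hmk
  have hk6 : (6 : ℝ) ≤ k := le_trans (by rw [le_div_iff₀ hε]; linarith) hk
  have hk0 : (0 : ℝ) < k := by linarith
  have hx6 : (6 : ℝ) ≤ m := by exact_mod_cast hm6
  have hx0 : (0 : ℝ) < m := by linarith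
  have hx1 : (1 : ℝ) ≤ m := by linarith
  set y : ℝ := (m : ℝ) ^ (ε / 4) with hy
  have hy2 : (m : ℝ) ^ (ε / 2) = y ^ 2 := by
    rw [hy, ← Real.rpow_natCast, ← Real.rpow_mul hx0.le]; congr 1; push_cast; ring
  have hy4 : (m : ℝ) ^ ε = y ^ 4 := by
    rw [hy, ← Real.rpow_natCast, ← Real.rpow_mul hx0.le]; congr 1; push_cast; ring
  have hy1 : 1 ≤ y := by linarith
  have hmN : (m : ℝ) ≤ (m : ℝ) ^ (2 - ε) := by
    calc (m : ℝ) = (m : ℝ) ^ (1 : ℝ) := (Real.rpow_one _).symm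
      _ ≤ _ := Real.rpow_le_rpow_of_exponent_le hx1 (by linarith)
  set N := ⌊(m : ℝ) ^ (2 - ε)⌋₊ with hN
  have hmN' : m ≤ N := Nat.le_floor hmN
  have hNle : (N : ℝ) ≤ (m : ℝ) ^ (2 - ε) := Nat.floor_le (by positivity)
  have hN0 : (0 : ℝ) < N := by
    have : (m : ℝ) ≤ N := by exact_mod_cast hmN'
    linarith
  have hk1 : 1 ≤ k := by
    have : (1 : ℝ) ≤ k := by linarith
    exact_mod_cast this
  set u := ⌈(m : ℝ) ^ (ε / 2)⌉₊ with hu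
  have hule : (u : ℝ) ≤ y ^ 2 + 1 := by
    rw [← hy2]
    exact (Nat.ceil_lt_add_one (by positivity)).le
  have huge : (m : ℝ) ^ (ε / 2) ≤ u := Nat.le_ceil _
  refine ⟨by omega, hmN'.trans (Nat.le_mul_of_pos_left _ hk1), ?_, ?_⟩
  · have h2k : 2 * k ≤ u := by
      have : (2 * k : ℝ) ≤ u := by
        rw [hy2] at huge
        nlinarith
      exact_mod_cast this
    have h3 : m ^ 3 ≤ u ^ k := by
      have : (m : ℝ) ^ 3 ≤ (u : ℝ) ^ k := by
        calc (m : ℝ) ^ 3 = (m : ℝ) ^ (3 : ℝ) := by norm_cast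
          _ ≤ (m : ℝ) ^ (ε / 2 * k) := by
              refine Real.rpow_le_rpow_of_exponent_le hx1 ?_
              rw [div_le_iff₀ hε] at hk
              linarith
          _ = ((m : ℝ) ^ (ε / 2)) ^ k := Real.rpow_mul_natCast hx0.le _ _
          _ ≤ _ := pow_le_pow_left₀ (by positivity) huge _
      exact_mod_cast this
    have h4 := h3.trans (pow_le_mul_choose h2k)
    have hpos : 0 < 2 ^ k * k.factorial := by positivity
    refine Nat.le_of_mul_le_mul_left ?_ hpos
    refine le_trans ?_ h4
    calc 2 ^ k * k.factorial * (2 * m ^ 2) = 2 * (2 ^ k * k.factorial) * m ^ 2 := by ring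
      _ ≤ m * m ^ 2 := Nat.mul_le_mul_right _ hmk
      _ = _ := by ring
  · have hl0 : 0 ≤ Real.log m := Real.log_nonneg hx1
    have hlogN : Real.log N ≤ 2 * Real.log m := by
      calc Real.log N ≤ Real.log ((m : ℝ) ^ (2 - ε)) := Real.log_le_log hN0 hNle
        _ = (2 - ε) * Real.log m := Real.log_rpow hx0 _
        _ ≤ _ := by nlinarith
    have hlogN0 : 0 ≤ Real.log N := Real.log_natCast_nonneg N
    have hlog6 : Real.log (6 * m) ≤ 2 * Real.log m := by
      rw [Real.log_mul (by norm_num) hx0.ne']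
      have := Real.log_le_log (by norm_num) hx6
      linarith
    have hpos : 0 < 6 * m * (N : ℝ) ^ u := by positivity
    rw [← Real.log_lt_iff_lt_exp hpos, Real.log_mul (by positivity) (by positivity), Real.log_pow]
    have hleft : Real.log (6 * m) + u * Real.log N ≤ 6 * y ^ 3 := by
      have h1 : (u : ℝ) * Real.log N ≤ (y ^ 2 + 1) * (2 * y) :=
        mul_le_mul hule (by linarith) hlogN0 (by positivity)
      have h2 : y ≤ y ^ 3 := by nlinarith [sq_nonneg y]
      nlinarith
    have hright : y ^ 4 / (4 * k) ≤ (m : ℝ) ^ 2 / (4 * (k * N : ℕ)) := by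
      have h1 : (m : ℝ) ^ ε * (m : ℝ) ^ (2 - ε) = (m : ℝ) ^ 2 := by
        rw [← Real.rpow_add hx0]
        norm_num
      push_cast
      rw [div_le_div_iff₀ (by positivity) (by positivity), ← hy4, ← h1]
      have h2 : (m : ℝ) ^ ε * N ≤ (m : ℝ) ^ ε * (m : ℝ) ^ (2 - ε) :=
        mul_le_mul_of_nonneg_left hNle (by positivity)
      nlinarith
    refine lt_of_le_of_lt hleft (lt_of_lt_of_le ?_ hright)
    rw [lt_div_iff₀ (by positivity)]
    have h3 : 0 < y ^ 3 := by positivity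
    nlinarith

/-- The almost-quadratic lower bound. -/
lemma exists_rpow_le_sumDistValue {ε : ℝ} (hε : 0 < ε) (hε1 : ε ≤ 1) :
    ∃ m₀ : ℕ, ∀ n m : ℕ, m₀ ≤ m → 1 ≤ n → (m : ℝ) ≤ (n : ℝ) ^ (1 / ε) →
      ∃ x ∈ Hypergraph.sumDistValues n m, (m : ℝ) ^ (2 - ε) ≤ x := by
  have hk := Nat.le_ceil (6 / ε)
  obtain ⟨m₀, h₀⟩ := Filter.eventually_atTop.1 (eventually_parameters hε hε1 hk)
  refine ⟨m₀, fun n m hm hn hmn => ?_⟩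
  obtain ⟨h1, h2, h3, h4⟩ := h₀ m hm
  have hn1 : (1 : ℝ) ≤ n := by exact_mod_cast hn
  -- The polynomial bound on `m` serves only to fit `U` into the `n` vertices.
  have hun : ⌈(m : ℝ) ^ (ε / 2)⌉₊ ≤ #(Finset.univ : Finset (Fin n)) := by
    rw [Finset.card_univ, Fintype.card_fin, Nat.ceil_le]
    calc (m : ℝ) ^ (ε / 2) ≤ ((n : ℝ) ^ (1 / ε)) ^ (ε / 2) :=
          Real.rpow_le_rpow (by positivity) hmn (by positivity)
      _ = (n : ℝ) ^ (1 / 2 : ℝ) := by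
          rw [← Real.rpow_mul (by positivity)]
          congr 1
          field_simp
      _ ≤ (n : ℝ) ^ (1 : ℝ) := Real.rpow_le_rpow_of_exponent_le hn1 (by norm_num)
      _ = n := Real.rpow_one _
  obtain ⟨U, -, hU⟩ := Finset.exists_subset_card_eq hun
  rw [← hU] at h3 h4
  obtain ⟨x, hx, hNx⟩ := exists_mem_sumDistValues_lt U (Nat.ceil_pos.2 (by positivity)) h1 h2 h3 h4
  refine ⟨x, hx, (Nat.lt_floor_add_one _).le.trans ?_⟩
  exact_mod_cast hNx

/-! ### Combining the bounds -/

lemma rpow_le_maxSumDistNumber_le {C : ℝ} (hC : 0 < C) {ε : ℝ} (hε : 0 < ε) :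
    ∃ n₀ : ℕ, ∀ n m : ℕ, n₀ < n → n ≤ m → (m : ℝ) ≤ (n : ℝ) ^ (1 / ε) →
      (m : ℝ) ^ (2 - ε) ≤ (Hypergraph.maxSumDistNumber n m : ℝ) ∧
      (Hypergraph.maxSumDistNumber n m : ℝ) ≤ (m : ℝ) ^ 2 / C := by
  have hC' : 1 ≤ ⌈C⌉₊ := Nat.ceil_pos.2 hC
  -- Lowering `ε` to at most 1 both enlarges the range of `m` and strengthens the lower bound.
  have hδ : 0 < min ε 1 := lt_min hε one_pos
  obtain ⟨m₁, h₁⟩ := exists_sumDistValues_mul_le hC'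
  obtain ⟨m₂, h₂⟩ := exists_rpow_le_sumDistValue hδ (min_le_right ε 1)
  refine ⟨m₁ + m₂, fun n m hn hnm hmn => ?_⟩
  have hn1 : (1 : ℝ) ≤ n := by
    have : 1 ≤ n := by omega
    exact_mod_cast this
  have hm1 : (1 : ℝ) ≤ m := by
    have : 1 ≤ m := by omega
    exact_mod_cast this
  -- This also shows the set of values bounded, and `x` below shows it nonempty, so `sSup` is a
  -- genuine supremum.
  have hup : ∀ k ∈ Hypergraph.sumDistValues n m, k ≤ m ^ 2 / ⌈C⌉₊ := fun k hk =>
    (Nat.le_div_iff_mul_le hC').2 (h₁ n m (by omega) k hk)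
  obtain ⟨x, hx, hmx⟩ := h₂ n m (by omega) (by omega) (hmn.trans
    (Real.rpow_le_rpow_of_exponent_le hn1
      (one_div_le_one_div_of_le hδ (min_le_left ε 1))))
  constructor
  · calc (m : ℝ) ^ (2 - ε) ≤ (m : ℝ) ^ (2 - min ε 1) :=
          Real.rpow_le_rpow_of_exponent_le hm1 (by linarith [min_le_left ε 1])
      _ ≤ x := hmx
      _ ≤ _ := by exact_mod_cast le_csSup ⟨_, hup⟩ hx
  · have h3 : Hypergraph.maxSumDistNumber n m ≤ m ^ 2 / ⌈C⌉₊ := csSup_le ⟨x, hx⟩ hup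
    have h4 : (Hypergraph.maxSumDistNumber n m : ℝ) * ⌈C⌉₊ ≤ (m : ℝ) ^ 2 := by
      exact_mod_cast (Nat.le_div_iff_mul_le hC').1 h3
    rw [le_div_iff₀ hC]
    exact le_trans (mul_le_mul_of_nonneg_left (Nat.le_ceil C) (by positivity)) h4

theorem theorem1 :
    (∀ C : ℝ, 0 < C → ∀ ε : ℝ, 0 < ε →
      ∃ n₀ : ℕ, ∀ n m : ℕ, n₀ < n → n ≤ m → (m : ℝ) ≤ (n : ℝ) ^ (1 / ε) →
        (m : ℝ) ^ (2 - ε) ≤ (Hypergraph.maxSumDistNumber n m : ℝ) ∧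
        (Hypergraph.maxSumDistNumber n m : ℝ) ≤ (m : ℝ) ^ 2 / C) ∧
    (∃ w : ℕ → ℕ → ℝ, ∀ a : ℝ, ∀ C : ℝ, ∀ δ : ℝ, 0 < δ →
      ∃ n₀ : ℕ, ∀ n m : ℕ, n₀ < n → n ≤ m → (m : ℝ) ≤ (n : ℝ) ^ a →
        (Hypergraph.maxSumDistNumber n m : ℝ) = (m : ℝ) ^ 2 / w n m ∧
        C ≤ w n m ∧ w n m ≤ (m : ℝ) ^ δ) := by
  refine ⟨fun C hC ε hε => rpow_le_maxSumDistNumber_le hC hε,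
    fun n m => (m : ℝ) ^ 2 / Hypergraph.maxSumDistNumber n m, fun a C δ hδ => ?_⟩
  have hC : 0 < max C 1 := lt_max_of_lt_right one_pos
  have ha : 0 < max a 1 := lt_max_of_lt_right one_pos
  -- Small enough that `m ^ ε ≤ m ^ δ` and `n ^ a ≤ n ^ (1 / ε)`.
  have hε : 0 < min δ (1 / max a 1) := lt_min hδ (by positivity)
  obtain ⟨n₀, h₀⟩ := rpow_le_maxSumDistNumber_le hC hε
  refine ⟨n₀, fun n m hn hnm hmn => ?_⟩
  have hn1 : (1 : ℝ) ≤ n := by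
    have : 1 ≤ n := by omega
    exact_mod_cast this
  have hm1 : (1 : ℝ) ≤ m := by
    have : 1 ≤ m := by omega
    exact_mod_cast this
  have hm0 : (0 : ℝ) < m := by linarith
  have haε : a ≤ 1 / min δ (1 / max a 1) := by
    refine (le_max_left a 1).trans ?_
    rw [le_one_div ha hε]
    exact min_le_right _ _
  obtain ⟨hlow, hup⟩ := h₀ n m hn hnm (hmn.trans (Real.rpow_le_rpow_of_exponent_le hn1 haε))
  set s : ℝ := (Hypergraph.maxSumDistNumber n m : ℝ) with hs
  have hs0 : 0 < s := lt_of_lt_of_le (by positivity) hlow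
  refine ⟨?_, ?_, ?_⟩
  · change s = (m : ℝ) ^ 2 / ((m : ℝ) ^ 2 / s)
    field_simp
  · refine (le_max_left C 1).trans ?_
    rw [le_div_iff₀ hs0]
    rw [le_div_iff₀ hC] at hup
    linarith
  · refine le_trans ?_ (Real.rpow_le_rpow_of_exponent_le hm1 (min_le_left δ (1 / max a 1)))
    rw [div_le_iff₀ hs0]
    calc (m : ℝ) ^ 2 = (m : ℝ) ^ min δ (1 / max a 1) * (m : ℝ) ^ (2 - min δ (1 / max a 1)) := by
          rw [← Real.rpow_add hm0]
          norm_num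
      _ ≤ _ := mul_le_mul_of_nonneg_left hlow (by positivity)
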